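/- \textbf{Definitions.} Let $e_1,\dots,e_M$ be the standard basis of $\mathbb{R}^M$. Subspaces $W_1,\dots,W_K$ of $\mathbb{R}^M$ with weights $v_1,\dots,v_K>0$ form a \emph{tight fusion frame} with bound $c>0$ if $\sum_{k=1}^K v_k^2\|P_kx\|^2=c\|x\|^2$ for all $x\in\mathbb{R}^M$, where $P_k$ is the orthogonal projection onto $W_k$. Vectors $f_1,\dots,f_N\in\mathbb{R}^M$ and a partition $J_1,\dots,J_K$ of $\{1,\dots,N\}$ \emph{generate} $\{W_k,v_k\}_{k=1}^K$ if, for each $k$, $(f_n)_{n\in J_k}$ is a tight frame for $W_k$ with bound $v_k^2$, i.e. $f_n\in W_k$ for $n\in J_k$ and $\sum_{n\in J_k}\langle x,f_n\rangle^2=v_k^2\|x\|^2$ for all $x\in W_k$. The \emph{spectral tetris construction with re-ordering} (STC/STR) takes eigenvalues $\lambda_1,\dots,\lambda_M$ and a list of norms $a_1,\dots,a_N$, which are variables that it changes, and starts with the cursor $(m,n)$ at $(1,1)$. As long as $m\le M$ it does the following step. \begin{itemize} \item If $\lambda_m\ge a_n^2$ (\emph{singleton}): put $f_n=a_ne_m$,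 replace $\lambda_m$ by $\lambda_m-a_n^2$ and $n$ by $n+1$; if now $\lambda_m=0$, replace $m$ by $m+1$. \item Otherwise, if $\lambda_m>a_{n+1}^2$ (\emph{re-ordering}): interchange the values of $a_n$ and $a_{n+1}$, then insert a singleton as above. \item Otherwise (\emph{$2\times 2$ block}): let $x=\lambda_m$ and $y=a_n^2+a_{n+1}^2-x$. If $x=y$, put $f_n=\sqrt{x/2}\,(e_m+e_{m+1})$ and $f_{n+1}=\sqrt{x/2}\,(e_m-e_{m+1})$; if $x\ne y$, put \[ f_n=\sqrt{\tfrac{x(a_n^2-y)}{x-y}}\,e_m+\sqrt{\tfrac{y(x-a_n^2)}{x-y}}\,e_{m+1},\qquad f_{n+1}=\sqrt{\tfrac{x(x-a_n^2)}{x-y}}\,e_m-\sqrt{\tfrac{y(a_n^2-y)}{x-y}}\,e_{m+1}. \] Replace $\lambda_{m+1}$ by $\lambda_{m+1}-y$, $\lambda_m$ by $0$, $n$ by $n+2$ and $m$ by $m+1$. \end{itemize} It gets stuck if a step needs a row or a column that does not exist. It \emph{outputs} $(f_n)_{n=1}^N$ if after finitely many steps all $M$ rows are finished and all $N$ columns are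 filled. \textbf{Corollary.} Let $M\ge1$, $d\ge 0$ and $K\ge2$ be integers, let $0<a_1\le a_2\le\dots\le a_K$, and let $\lambda=\frac{d}{M}\sum_{k=1}^Ka_k^2$ (by the trace condition, the only possible bound of a tight fusion frame in $\mathbb{R}^M$ with the weights $a_k$ and all subspaces of dimension $d$). Suppose that \[ \text{(i)}\quad a_{K-1}^2+a_K^2\le\lambda ,\qquad\qquad \text{(ii)}\quad \frac dM\le\frac12 . \] Then STC/STR, run on the $M$ eigenvalues $\lambda,\dots,\lambda$ and on the list of $N=dK$ norms \[ a_1,\dots,a_K,\ a_1,\dots,a_K,\ \dots,\ a_1,\dots,a_K \qquad (d\text{ periods}), \] outputs vectors $f_1,\dots,f_N$ that, together with some partition of $\{1,\dots,N\}$ into $K$ sets, generate $\{W_k,a_k\}_{k=1}^K$ for subspaces $W_1,\dots,W_K$ of $\mathbb{R}^M$ which all have dimension $d$, and $\{W_k,a_k\}_{k=1}^K$ is a tight fusion frame with bound $\lambda$. -/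

import Mathlib

/-- A finite family `W k` of subspaces of `ℝ^M` with weights `v k > 0` is a tight fusion frame with
bound `c > 0`: `∑ₖ vₖ² ‖Pₖ x‖² = c ‖x‖²` for all `x`, where `Pₖ` is the orthogonal projection
onto `W k`. -/
def IsTightFusionFrame {M K : ℕ} (W : Fin K → Submodule ℝ (EuclideanSpace ℝ (Fin M)))
    (v : Fin K → ℝ) (c : ℝ) : Prop :=
  (∀ k, 0 < v k) ∧ 0 < c ∧
    ∀ x : EuclideanSpace ℝ (Fin M), ∑ k, v k ^ 2 * ‖(W k).starProjection x‖ ^ 2 = c * ‖x‖ ^ 2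

/-- The vectors `f n`, `n ∈ J`, form a tight frame for the subspace `W` with bound `c > 0`. -/
def IsTightFrameFor {M N : ℕ} (f : Fin N → EuclideanSpace ℝ (Fin M)) (J : Finset (Fin N))
    (W : Submodule ℝ (EuclideanSpace ℝ (Fin M))) (c : ℝ) : Prop :=
  0 < c ∧ (∀ n ∈ J, f n ∈ W) ∧ ∀ x ∈ W, ∑ n ∈ J, inner ℝ x (f n) ^ 2 = c * ‖x‖ ^ 2

/-- The vectors `f n`, split up by the partition `{n | J n = k}`, `k = 1, …, K`, generate the
weighted subspaces `(W k, v k)`: the `k`-th part is a tight frame for `W k` with bound `(v k)²`. -/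
def Generates {M N K : ℕ} (f : Fin N → EuclideanSpace ℝ (Fin M)) (J : Fin N → Fin K)
    (W : Fin K → Submodule ℝ (EuclideanSpace ℝ (Fin M))) (v : Fin K → ℝ) : Prop :=
  ∀ k, IsTightFrameFor f (Finset.univ.filter fun n => J n = k) (W k) (v k ^ 2)

/-- The memory of the spectral tetris construction: the cursor `(row, col)` (counted from `0`), the
current values `eig m` of the variables `λₘ`, the current list `nrm` of norms (which the
re-ordering permutes) and the vectors `vec n` written so far. -/
structure STState (M N : ℕ) where
  row : ℕ
  col : ℕ
  eig : Fin M → ℝ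
  nrm : Fin N → ℝ
  vec : Fin N → EuclideanSpace ℝ (Fin M)

namespace STState

variable {M N : ℕ}

/-- The state before the first step, for the eigenvalues `lam` and the list `a` of norms. -/
noncomputable def init (lam : Fin M → ℝ) (a : Fin N → ℝ) : STState M N :=
  { row := 0, col := 0, eig := lam, nrm := a, vec := fun _ => 0 }

/-- Insert a singleton at `(m, n)`: `fₙ = aₙ eₘ`, `λₘ ← λₘ - aₙ²`, `n ← n + 1`; the cursor leaves
row `m` if the new `λₘ` is `0`. -/
noncomputable def singleton (s : STState M N) (m : Fin M) (n : Fin N) : STState M N :=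
  { row := if s.eig m - s.nrm n ^ 2 = 0 then s.row + 1 else s.row
    col := s.col + 1
    eig := Function.update s.eig m (s.eig m - s.nrm n ^ 2)
    nrm := s.nrm
    vec := Function.update s.vec n (s.nrm n • EuclideanSpace.single m 1) }

/-- Insert the vectors `g`, `h` of a `2 × 2` block at columns `n`, `n'` and rows `m`, `m'`:
`λₘ' ← λₘ' - (aₙ² + aₙ'² - λₘ)`, `λₘ ← 0`, `n ← n + 2`; row `m` is finished. -/
noncomputable def block (s : STState M N) (m m' : Fin M) (n n' : Fin N)
    (g h : EuclideanSpace ℝ (Fin M)) : STState M N :=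
  { row := s.row + 1
    col := s.col + 2
    eig := Function.update
      (Function.update s.eig m' (s.eig m' - (s.nrm n ^ 2 + s.nrm n' ^ 2 - s.eig m))) m 0
    nrm := s.nrm
    vec := Function.update (Function.update s.vec n g) n' h }

/-- The re-ordering: interchange the norms at positions `n` and `n'`. -/
def swapNorms (s : STState M N) (n n' : Fin N) : STState M N :=
  { s with nrm := s.nrm ∘ Equiv.swap n n' }

/-- One step of the spectral tetris construction with re-ordering (STC/STR), with the cursor at
`(m, n)`. If `aₙ² ≤ λₘ`, insert a singleton. Otherwise, if `aₙ₊₁² < λₘ` (no block exists),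
interchange `aₙ` and `aₙ₊₁` and insert a singleton; if not, insert a `2 × 2` block.
The value is `none` if the construction has stopped (no row is left) or is stuck (it needs a row
or a column that does not exist). -/
noncomputable def step (s : STState M N) : Option (STState M N) :=
  if hm : s.row < M then
    if hn : s.col < N then
      let m : Fin M := ⟨s.row, hm⟩
      let n : Fin N := ⟨s.col, hn⟩
      if s.nrm n ^ 2 ≤ s.eig m then some (s.singleton m n)
      else if hn' : s.col + 1 < N then
        let n' : Fin N := ⟨s.col + 1, hn'⟩
        if s.nrm n' ^ 2 < s.eig m then some ((s.swapNorms n n').singleton m n)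
        else if hm' : s.row + 1 < M then
          let m' : Fin M := ⟨s.row + 1, hm'⟩
          let e : EuclideanSpace ℝ (Fin M) := EuclideanSpace.single m 1
          let e' : EuclideanSpace ℝ (Fin M) := EuclideanSpace.single m' 1
          let x : ℝ := s.eig m
          if 2 * x = s.nrm n ^ 2 + s.nrm n' ^ 2 then
            some (s.block m m' n n' (√(x / 2) • (e + e')) (√(x / 2) • (e - e')))
          else
            let y : ℝ := s.nrm n ^ 2 + s.nrm n' ^ 2 - x
            some (s.block m m' n n'
              (√(x * (s.nrm n ^ 2 - y) / (x - y)) • e + √(y * (x - s.nrm n ^ 2) / (x - y)) • e')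
              (√(x * (x - s.nrm n ^ 2) / (x - y)) • e - √(y * (s.nrm n ^ 2 - y) / (x - y)) • e'))
        else none
      else none
    else none
  else none

end STState

/-- STC/STR, run on the eigenvalues `lam` and the list `a` of norms, stops after finitely many
steps with all `M` rows finished and all `N` columns filled, and outputs the vectors `f`. -/
def STOutputs {M N : ℕ} (lam : Fin M → ℝ) (a : Fin N → ℝ)
    (f : Fin N → EuclideanSpace ℝ (Fin M)) : Prop :=
  ∃ s : STState M N,
    Relation.ReflTransGen (fun s t : STState M N => s.step = some t) (STState.init lam a) s ∧
      s.row = M ∧ s.col = N ∧ s.vec = f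

/-- The periodic list `a₁, …, a_K, a₁, …, a_K, …, a₁, …, a_K` of `d` periods. -/
def periodicList {K : ℕ} (d : ℕ) (a : Fin K → ℝ) : Fin (d * K) → ℝ := fun n => a n.modNat

/-! Let `b` be the periodic sequence of squared norms and `T i` the sum of its first `i` terms. The
central claim is that a vector whose norm stood at position `p` of the original list can only meet a
row `r` (counted from `0`) with `r * lam ≤ T (p + 1) < (r + 2) * lam`, even though re-ordering may
place it late. Hypothesis (ii) says that one period of `b` sums to at least `2 * lam`. Two vectors
with the same weight come from positions at least `K` apart, so the half-open windows keep their
supports disjoint and they are orthogonal. Each weight class thus consists of `d` orthogonal vectors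
of norm `a k`: a tight frame for its `d`-dimensional span. The rows of the output are orthogonal
with squared norm `lam`, and summing over the classes gives the fusion frame identity.

Hypothesis (i) keeps the construction from getting stuck: two norms less than `K` positions apart
have squares summing to at most `lam`, so a block always leaves a positive remainder in the next
row. Re-ordering carries at most one large norm along at a time, always within its row, and for
fewer than `K` positions. `Filled` and `Ready` hold these invariants, `Ready.exists_step` preserves
them, and `Filled.inner_eq_zero` extracts orthogonality. -/

theorem Finset.sum_update_mul_update {M N : ℕ} (v : Fin N → EuclideanSpace ℝ (Fin M)) (n : Fin N)
    (hn : v n = 0) (g : EuclideanSpace ℝ (Fin M)) (r t : Fin M) :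
    ∑ j, Function.update v n g j r * Function.update v n g j t
      = (∑ j, v j r * v j t) + g r * g t := by
  have h1 := Finset.add_sum_erase Finset.univ
    (fun j => Function.update v n g j r * Function.update v n g j t) (Finset.mem_univ n)
  have h2 := Finset.add_sum_erase Finset.univ (fun j => v j r * v j t) (Finset.mem_univ n)
  have h3 : ∑ j ∈ Finset.univ.erase n, Function.update v n g j r * Function.update v n g j t
      = ∑ j ∈ Finset.univ.erase n, v j r * v j t := by
    refine Finset.sum_congr rfl fun j hj => ?_
    rw [Function.update_of_ne (Finset.ne_of_mem_erase hj)]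
  simp only [Function.update_self, hn, PiLp.zero_apply, mul_zero, zero_add] at h1 h2
  rw [← h1, h3, h2, add_comm]

theorem EuclideanSpace.sum_sq_single_add_single {M : ℕ} {m m' : Fin M} (h : m ≠ m') (c c' : ℝ) :
    ∑ r, (c • EuclideanSpace.single m (1 : ℝ) + c' • EuclideanSpace.single m' (1 : ℝ) :
      EuclideanSpace ℝ (Fin M)) r ^ 2 = c ^ 2 + c' ^ 2 := by
  have : ∀ r, (c • EuclideanSpace.single m (1 : ℝ) + c' • EuclideanSpace.single m' (1 : ℝ) :
      EuclideanSpace ℝ (Fin M)) r ^ 2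
      = (if r = m then c ^ 2 else 0) + (if r = m' then c' ^ 2 else 0) := by
    intro r
    by_cases h1 : r = m
    · have : r ≠ m' := fun h2 => h (h1.symm.trans h2)
      simp [h1, h]
    · by_cases h2 : r = m' <;> simp [h1, h2, Ne.symm h]
  rw [Finset.sum_congr rfl fun r _ => this r]
  simp [Finset.sum_add_distrib]

/-! ### The support window and Gram invariant under each elementary operation -/

namespace STState

variable {M N : ℕ}

/-- The columns before the cursor are filled: `σ` records the re-ordering of the original list
`α`, the rows of the vectors written so far are orthogonal and have used up `lam - eig`, the vectors
have the norms demanded by the list, and the support of each of them is controlled by the partial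
sum of the original squared norms up to its original position. -/
structure Filled (lam : ℝ) (T : ℕ → ℝ) (α : Fin N → ℝ) (σ : Equiv.Perm (Fin N))
    (s : STState M N) : Prop where
  nrm_eq : s.nrm = α ∘ σ
  vec_zero : ∀ j : Fin N, s.col ≤ j → s.vec j = 0
  gram : ∀ r t, ∑ j, s.vec j r * s.vec j t = if r = t then lam - s.eig r else 0
  norm : ∀ j : Fin N, (j : ℕ) < s.col → ∑ r, s.vec j r ^ 2 = s.nrm j ^ 2
  supp : ∀ j : Fin N, (j : ℕ) < s.col → ∀ r : Fin M, s.vec j r ≠ 0 →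
    (r : ℝ) * lam ≤ T (σ j + 1) ∧ T (σ j + 1) < (r + 2) * lam
  eig_below : ∀ r : Fin M, (r : ℕ) < s.row → s.eig r = 0
  eig_above : ∀ r : Fin M, s.row < (r : ℕ) → s.eig r = lam

variable {lam : ℝ} {T : ℕ → ℝ} {α : Fin N → ℝ} {σ : Equiv.Perm (Fin N)} {s : STState M N}

theorem Filled.init : (STState.init (M := M) (fun _ => lam) α).Filled lam T α 1 where
  nrm_eq := rfl
  vec_zero _ _ := rfl
  gram r t := by simp [STState.init]
  norm j hj := absurd hj (Nat.not_lt_zero _)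
  supp j hj := absurd hj (Nat.not_lt_zero _)
  eig_below j hj := absurd hj (Nat.not_lt_zero _)
  eig_above _ _ := rfl

/-- Only positions not yet filled are exchanged, so every written vector keeps its norm and its
original position. -/
theorem Filled.swapNorms (hs : s.Filled lam T α σ) {n n' : Fin N} (hn : s.col ≤ n)
    (hn' : s.col ≤ n') : (s.swapNorms n n').Filled lam T α (σ * Equiv.swap n n') := by
  have key : ∀ j : Fin N, (j : ℕ) < s.col → Equiv.swap n n' j = j := fun j hj =>
    Equiv.swap_apply_of_ne_of_ne (by rintro rfl; omega) (by rintro rfl; omega)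
  refine ⟨?_, hs.vec_zero, hs.gram, ?_, ?_, hs.eig_below, hs.eig_above⟩
  · simp [STState.swapNorms, hs.nrm_eq, Function.comp_assoc]
  · intro j hj
    simpa [STState.swapNorms, key j hj] using hs.norm j hj
  · intro j hj
    simpa [STState.swapNorms, key j hj] using hs.supp j hj

theorem Filled.singleton (hs : s.Filled lam T α σ) {m : Fin M} {n : Fin N}
    (hm : (m : ℕ) = s.row) (hn : (n : ℕ) = s.col)
    (h1 : (m : ℝ) * lam ≤ T (σ n + 1)) (h2 : T (σ n + 1) < (m + 2) * lam) :
    (s.singleton m n).Filled lam T α σ := by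
  have hz := hs.vec_zero n hn.ge
  refine ⟨hs.nrm_eq, ?_, ?_, ?_, ?_, ?_, ?_⟩
  · intro j hj
    simp only [STState.singleton] at hj ⊢
    have : j ≠ n := by rintro rfl; omega
    rw [Function.update_of_ne this]
    exact hs.vec_zero j (by omega)
  · intro r t
    simp only [STState.singleton]
    rw [Finset.sum_update_mul_update _ _ hz, hs.gram]
    by_cases hrt : r = t
    · subst hrt
      by_cases hr : r = m
      · subst hr; simp; ring
      · simp [hr]
    · by_cases hr : r = m
      · subst hr; simp [hrt, Ne.symm hrt]
      · simp [hr, hrt]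
  · intro j hj
    simp only [STState.singleton] at hj ⊢
    by_cases hjn : j = n
    · subst hjn
      simp [ite_pow]
    · rw [Function.update_of_ne hjn]
      exact hs.norm j (by have : (j : ℕ) ≠ n := fun h => hjn (Fin.ext h); omega)
  · intro j hj r hr
    simp only [STState.singleton] at hj hr
    by_cases hjn : j = n
    · subst hjn
      have : r = m := by
        by_contra h
        simp [h] at hr
      subst this
      exact ⟨h1, h2⟩
    · rw [Function.update_of_ne hjn] at hr
      exact hs.supp j (by have : (j : ℕ) ≠ n := fun h => hjn (Fin.ext h); omega) r hr
  · intro r hr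
    simp only [STState.singleton] at hr ⊢
    by_cases hrm : r = m
    · subst hrm
      rw [Function.update_self]
      by_contra h
      rw [if_neg h] at hr
      omega
    · rw [Function.update_of_ne hrm]
      have : (r : ℕ) ≠ m := fun h => hrm (Fin.ext h)
      exact hs.eig_below r (by split_ifs at hr <;> omega)
  · intro r hr
    simp only [STState.singleton] at hr ⊢
    have hrow : s.row < r := by split_ifs at hr <;> omega
    rw [Function.update_of_ne (by rintro rfl; omega)]
    exact hs.eig_above r hrow

/-- Both vectors may meet rows `m` and `m + 1`, so their partial sums must lie in the intersection
of the two row windows, which is `[(m + 1) * lam, (m + 2) * lam)`. The equations on the `c`'s are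
all the invariant needs; the explicit square roots play no role here. -/
theorem Filled.block (hs : s.Filled lam T α σ) {m m' : Fin M} {n n' : Fin N}
    (hm : (m : ℕ) = s.row) (hm' : (m' : ℕ) = s.row + 1)
    (hn : (n : ℕ) = s.col) (hn' : (n' : ℕ) = s.col + 1) {c₁ c₂ c₃ c₄ : ℝ}
    (hc₁ : c₁ ^ 2 + c₂ ^ 2 = s.nrm n ^ 2) (hc₂ : c₃ ^ 2 + c₄ ^ 2 = s.nrm n' ^ 2)
    (hr : c₁ ^ 2 + c₃ ^ 2 = s.eig m) (ho : c₁ * c₂ + c₃ * c₄ = 0)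
    (h1 : ((m : ℝ) + 1) * lam ≤ T (σ n + 1)) (h2 : T (σ n + 1) < (m + 2) * lam)
    (h1' : ((m : ℝ) + 1) * lam ≤ T (σ n' + 1)) (h2' : T (σ n' + 1) < (m + 2) * lam)
    (hlam : 0 < lam) :
    (s.block m m' n n' (c₁ • EuclideanSpace.single m 1 + c₂ • EuclideanSpace.single m' 1)
      (c₃ • EuclideanSpace.single m 1 + c₄ • EuclideanSpace.single m' 1)).Filled lam T α σ := by
  have hmm : m ≠ m' := by rintro rfl; omega
  have hnn : n ≠ n' := by rintro rfl; omega
  have hz := hs.vec_zero n hn.ge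
  have hz' := hs.vec_zero n' (by omega)
  have hsupp : ∀ (c c' : ℝ) (r : Fin M),
      (c • EuclideanSpace.single m (1 : ℝ) + c' • EuclideanSpace.single m' (1 : ℝ) :
        EuclideanSpace ℝ (Fin M)) r ≠ 0 →
      ∀ j, ((m : ℝ) + 1) * lam ≤ T j → T j < (m + 2) * lam →
        (r : ℝ) * lam ≤ T j ∧ T j < (r + 2) * lam := by
    intro c c' r hr j h h'
    by_cases hrm : r = m
    · subst hrm; exact ⟨by linarith, h'⟩
    · by_cases hrm' : r = m'
      · subst hrm'
        have : ((r : ℕ) : ℝ) = m + 1 := by rw [hm', hm]; push_cast; ring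
        rw [this]
        exact ⟨h, by linarith⟩
      · simp [hrm, hrm'] at hr
  refine ⟨hs.nrm_eq, ?_, ?_, ?_, ?_, ?_, ?_⟩
  · intro j hj
    simp only [STState.block] at hj ⊢
    rw [Function.update_of_ne (by rintro rfl; omega), Function.update_of_ne (by rintro rfl; omega)]
    exact hs.vec_zero j (by omega)
  · intro r t
    simp only [STState.block]
    rw [Finset.sum_update_mul_update _ _ (by rw [Function.update_of_ne hnn.symm, hz']),
      Finset.sum_update_mul_update _ _ hz, hs.gram]
    -- The total squared norm of the block minus its share in row `m` is exactly what it uses of row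
    -- `m'`.
    have hy : s.nrm n ^ 2 + s.nrm n' ^ 2 - s.eig m = c₂ ^ 2 + c₄ ^ 2 := by linarith
    by_cases hrm : r = m
    · subst hrm
      by_cases htm : t = r
      · subst htm; simp [hmm]; linarith
      · by_cases htm' : t = m'
        · subst htm'; simp [hmm, hmm.symm]; linarith
        · simp [htm, htm', Ne.symm htm]
    · by_cases hrm' : r = m'
      · subst hrm'
        by_cases htm : t = r
        · subst htm; simp [hmm.symm]; linarith
        · by_cases htm' : t = m
          · subst htm'; simp [hmm, hmm.symm]; linarith
          · simp [htm, htm', Ne.symm htm]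
      · simp [hrm, hrm']
  · intro j hj
    simp only [STState.block] at hj ⊢
    by_cases hjn' : j = n'
    · subst hjn'
      rw [Function.update_self, EuclideanSpace.sum_sq_single_add_single hmm, hc₂]
    · rw [Function.update_of_ne hjn']
      by_cases hjn : j = n
      · subst hjn
        rw [Function.update_self, EuclideanSpace.sum_sq_single_add_single hmm, hc₁]
      · rw [Function.update_of_ne hjn]
        have : (j : ℕ) ≠ n := fun h => hjn (Fin.ext h)
        have : (j : ℕ) ≠ n' := fun h => hjn' (Fin.ext h)
        exact hs.norm j (by omega)
  · intro j hj r hr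
    simp only [STState.block] at hj hr
    by_cases hjn' : j = n'
    · subst hjn'
      rw [Function.update_self] at hr
      exact hsupp _ _ r hr _ h1' h2'
    · rw [Function.update_of_ne hjn'] at hr
      by_cases hjn : j = n
      · subst hjn
        rw [Function.update_self] at hr
        exact hsupp _ _ r hr _ h1 h2
      · rw [Function.update_of_ne hjn] at hr
        have : (j : ℕ) ≠ n := fun h => hjn (Fin.ext h)
        have : (j : ℕ) ≠ n' := fun h => hjn' (Fin.ext h)
        exact hs.supp j (by omega) r hr
  · intro r hr
    simp only [STState.block] at hr ⊢
    by_cases hrm : r = m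
    · subst hrm; rw [Function.update_self]
    · have : (r : ℕ) ≠ m := fun h => hrm (Fin.ext h)
      rw [Function.update_of_ne hrm, Function.update_of_ne (by rintro rfl; omega)]
      exact hs.eig_below r (by omega)
  · intro r hr
    simp only [STState.block] at hr ⊢
    rw [Function.update_of_ne (by rintro rfl; omega), Function.update_of_ne (by rintro rfl; omega)]
    exact hs.eig_above r (by omega)

end STState

/-! ### Periodic weights and their partial sums -/

/-- A sequence `b` of positive weights whose partial sum up to `N` is `M * lam`, such that
weights at positions less than `K` apart sum to at most `lam`, and those of `K` consecutive
positions to at least `2 * lam`. -/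
structure PeriodicWeights (M N K : ℕ) (lam : ℝ) (b : ℕ → ℝ) : Prop where
  two_le : 2 ≤ K
  pos : ∀ i, 0 < b i
  pair_le : ∀ i j, i < j → j < i + K → b i + b j ≤ lam
  period_le : ∀ i, ∑ j ∈ Finset.range i, b j + 2 * lam ≤ ∑ j ∈ Finset.range (i + K), b j
  total : ∑ j ∈ Finset.range N, b j = M * lam

namespace PeriodicWeights

variable {M N K : ℕ} {lam : ℝ} {b : ℕ → ℝ}

theorem strictMono (hb : PeriodicWeights M N K lam b) :
    StrictMono fun n => ∑ j ∈ Finset.range n, b j :=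
  strictMono_nat_of_lt_succ fun n => by
    rw [Finset.sum_range_succ]
    linarith [hb.pos n]

theorem lt_lam (hb : PeriodicWeights M N K lam b) (i : ℕ) : b i < lam := by
  have h := hb.pair_le i (i + 1) (by omega) (by have := hb.two_le; omega)
  linarith [hb.pos (i + 1)]

theorem lam_pos (hb : PeriodicWeights M N K lam b) : 0 < lam :=
  (hb.pos 0).trans (hb.lt_lam 0)

end PeriodicWeights

/-! ### Progress and termination of the construction -/

namespace STState

variable {M N : ℕ}

theorem step_eq_singleton {s : STState M N} {m : Fin M} {n : Fin N} (hm : (m : ℕ) = s.row)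
    (hn : (n : ℕ) = s.col) (h : s.nrm n ^ 2 ≤ s.eig m) : s.step = some (s.singleton m n) := by
  obtain ⟨m, h1⟩ := m
  obtain rfl : m = s.row := hm
  obtain ⟨n, h2⟩ := n
  obtain rfl : n = s.col := hn
  simp [step, h1, h2, h]

theorem step_eq_swap {s : STState M N} {m : Fin M} {n n' : Fin N} (hm : (m : ℕ) = s.row)
    (hn : (n : ℕ) = s.col) (hn' : (n' : ℕ) = s.col + 1) (h : s.eig m < s.nrm n ^ 2)
    (h' : s.nrm n' ^ 2 < s.eig m) : s.step = some ((s.swapNorms n n').singleton m n) := by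
  obtain ⟨m, h1⟩ := m
  obtain rfl : m = s.row := hm
  obtain ⟨n, h2⟩ := n
  obtain rfl : n = s.col := hn
  obtain ⟨n', h3⟩ := n'
  obtain rfl : n' = s.col + 1 := hn'
  simp [step, h1, h2, h3, h.not_ge, h']

/-- The coefficients of a `2 × 2` block with row sums `x`, `y` and squared norms `p`, `q`. -/
theorem block_coefficients {x y p q : ℝ} (hx : 0 < x) (hp : x < p) (hq : x ≤ q)
    (hy : p + q - x = y) :
    √(x * (p - y) / (x - y)) ^ 2 + √(y * (x - p) / (x - y)) ^ 2 = p ∧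
    √(x * (x - p) / (x - y)) ^ 2 + (-√(y * (p - y) / (x - y))) ^ 2 = q ∧
    √(x * (p - y) / (x - y)) ^ 2 + √(x * (x - p) / (x - y)) ^ 2 = x ∧
    √(x * (p - y) / (x - y)) * √(y * (x - p) / (x - y))
      + √(x * (x - p) / (x - y)) * -√(y * (p - y) / (x - y)) = 0 := by
  obtain rfl : q = x + y - p := by linarith
  -- With `q = x + y - p`, both `p - y` and `x - p` are nonpositive, so every radicand is a quotient
  -- of nonpositive numbers.
  have hxy : x - y < 0 := by linarith
  have hy0 : 0 < y := by linarith
  have e : ∀ u v : ℝ, 0 < u → v ≤ 0 → 0 ≤ u * v / (x - y) := fun u v hu hv =>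
    div_nonneg_of_nonpos (mul_nonpos_of_nonneg_of_nonpos hu.le hv) hxy.le
  have e1 := e x (p - y) hx (by linarith)
  have e2 := e y (x - p) hy0 (by linarith)
  have e3 := e x (x - p) hx (by linarith)
  have e4 := e y (p - y) hy0 (by linarith)
  have hxy' := hxy.ne
  rw [neg_sq, Real.sq_sqrt e1, Real.sq_sqrt e2, Real.sq_sqrt e3, Real.sq_sqrt e4, mul_neg,
    ← Real.sqrt_mul e1, ← Real.sqrt_mul e3]
  refine ⟨by field_simp; ring, by field_simp; ring, by field_simp; ring, ?_⟩
  rw [add_neg_eq_zero]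
  congr 1
  ring

/-- If neither a singleton nor a re-ordering is possible, the next step inserts a `2 × 2` block whose
coefficients satisfy the norm and orthogonality relations. -/
theorem exists_step_eq_block {s : STState M N} {m m' : Fin M} {n n' : Fin N}
    (hm : (m : ℕ) = s.row) (hm' : (m' : ℕ) = s.row + 1) (hn : (n : ℕ) = s.col)
    (hn' : (n' : ℕ) = s.col + 1) (hpos : 0 < s.eig m) (h : s.eig m < s.nrm n ^ 2)
    (h' : s.eig m ≤ s.nrm n' ^ 2) :
    ∃ c₁ c₂ c₃ c₄ : ℝ,
      s.step = some (s.block m m' n n'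
        (c₁ • EuclideanSpace.single m 1 + c₂ • EuclideanSpace.single m' 1)
        (c₃ • EuclideanSpace.single m 1 + c₄ • EuclideanSpace.single m' 1)) ∧
      c₁ ^ 2 + c₂ ^ 2 = s.nrm n ^ 2 ∧ c₃ ^ 2 + c₄ ^ 2 = s.nrm n' ^ 2 ∧
      c₁ ^ 2 + c₃ ^ 2 = s.eig m ∧ c₁ * c₂ + c₃ * c₄ = 0 := by
  obtain ⟨m, h1⟩ := m
  obtain rfl : m = s.row := hm
  obtain ⟨m', h4⟩ := m'
  obtain rfl : m' = s.row + 1 := hm'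
  obtain ⟨n, h2⟩ := n
  obtain rfl : n = s.col := hn
  obtain ⟨n', h3⟩ := n'
  obtain rfl : n' = s.col + 1 := hn'
  -- Since the remainder is less than one squared norm and at most the other, the degenerate case `x
  -- = y` never occurs.
  have hne : ¬ (2 * s.eig ⟨s.row, h1⟩
      = s.nrm ⟨s.col, h2⟩ ^ 2 + s.nrm ⟨s.col + 1, h3⟩ ^ 2) := by linarith
  refine ⟨_, _, _, _, ?_, block_coefficients hpos h h' rfl⟩
  simp only [step, h1, h2, h3, h4, h.not_ge, h'.not_gt, hne, dif_pos, if_false, neg_smul,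
    sub_eq_add_neg (_ • _)]

/-- The cursor is at row `m` and column `n`, and `n` is about to be filled. Either the list is in the
original order from `n` on, or a large norm from the original position `σ n < n` has been
postponed within row `m`. -/
structure Ready (K : ℕ) (lam : ℝ) (b : ℕ → ℝ) (α : Fin N → ℝ) (σ : Equiv.Perm (Fin N))
    (s : STState M N) (m : Fin M) (n : Fin N) : Prop extends
    Filled lam (fun i => ∑ j ∈ Finset.range i, b j) α σ s where
  row_eq : (m : ℕ) = s.row
  col_eq : (n : ℕ) = s.col
  perm_eq : ∀ j, n < j → σ j = j
  eig_pos : 0 < s.eig m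
  eig_le : s.eig m ≤ lam
  perm_le : (σ n : ℕ) ≤ n
  lt_perm : (n : ℕ) < σ n + K
  partial_sum : ∑ j ∈ Finset.range (n + 1), b j - b (σ n) = (m + 1) * lam - s.eig m
  postponed : σ n = n ∨
    (s.eig m < b (σ n) ∧ (m + 1) * lam < ∑ j ∈ Finset.range (σ n + 1), b j)

variable {K : ℕ} {lam : ℝ} {b : ℕ → ℝ} {α : Fin N → ℝ} {σ : Equiv.Perm (Fin N)} {s : STState M N}

/-- With no postponed norm, the partial sum up to the cursor equals the mass used in the rows. As
partial sums increase strictly, rows and columns run out together. -/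
theorem Filled.ready_or_done (hb : PeriodicWeights M N K lam b)
    (hs : s.Filled lam (fun i => ∑ j ∈ Finset.range i, b j) α σ)
    (hσ : ∀ j : Fin N, s.col ≤ j → σ j = j) (hrow : s.row ≤ M)
    (heig : ∀ m : Fin M, (m : ℕ) = s.row → 0 < s.eig m ∧ s.eig m ≤ lam ∧
      ∑ j ∈ Finset.range s.col, b j = (m + 1) * lam - s.eig m)
    (hend : s.row = M → ∑ j ∈ Finset.range s.col, b j = M * lam) :
    (∃ m n, s.Ready K lam b α σ m n) ∨ (s.row = M ∧ s.col = N) := by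
  rcases hrow.eq_or_lt with h | h
  · refine Or.inr ⟨h, hb.strictMono.injective ?_⟩
    simp only [hend h, hb.total]
  · refine Or.inl ?_
    obtain ⟨h1, h2, h3⟩ := heig ⟨s.row, h⟩ rfl
    have hcol : s.col < N := by
      refine hb.strictMono.lt_iff_lt.1 ?_
      simp only [h3, hb.total]
      have : ((s.row : ℝ) + 1) ≤ M := by exact_mod_cast h
      nlinarith [hb.lam_pos]
    have hσn := hσ ⟨s.col, hcol⟩ le_rfl
    refine ⟨⟨s.row, h⟩, ⟨s.col, hcol⟩, { hs with
      row_eq := rfl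
      col_eq := rfl
      perm_eq := fun j hj => hσ j hj.le
      eig_pos := h1
      eig_le := h2
      perm_le := by rw [hσn]
      lt_perm := by rw [hσn]; have := hb.two_le; simp only; omega
      partial_sum := ?_
      postponed := Or.inl hσn }⟩
    rw [hσn, ← h3, Finset.sum_range_succ, add_sub_cancel_right]

/-- In a ready state whose current norm is too large for a singleton, the partial sum including the
current norm lies strictly between two consecutive multiples of `lam`. -/
theorem Ready.perm_sum_gt {m : Fin M} {n : Fin N} (hs : s.Ready K lam b α σ m n)
    (h : s.eig m < b (σ n)) : (m + 1) * lam < ∑ j ∈ Finset.range (σ n + 1), b j := by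
  rcases hs.postponed with h1 | h1
  · have := hs.partial_sum
    rw [h1] at this h ⊢
    linarith
  · exact h1.2

/-- The mass through position `n` lies strictly between `(m + 1) * lam` and `(m + 2) * lam`, while
the total is `M * lam`; so a further row and then a further column exist. The last bound limits how
long a norm can be postponed. -/
theorem Ready.exists_next (hb : PeriodicWeights M N K lam b) {m : Fin M} {n : Fin N}
    (hs : s.Ready K lam b α σ m n) (h : s.eig m < b (σ n)) :
    (n : ℕ) + 1 < N ∧ (m : ℕ) + 1 < M ∧ (n : ℕ) + 1 < σ n + K := by
  have hp := hs.partial_sum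
  have hl := hb.lam_pos
  have hbl := hb.lt_lam (σ n)
  have he := hs.eig_pos
  have hm : (m : ℕ) + 1 < M := by
    have h1 : ∑ j ∈ Finset.range (n + 1), b j ≤ ∑ j ∈ Finset.range N, b j :=
      hb.strictMono.monotone n.2
    rw [hb.total] at h1
    have h2 : ((m : ℝ) + 1) * lam < M * lam := by linarith
    exact_mod_cast lt_of_mul_lt_mul_right h2 hl.le
  refine ⟨hb.strictMono.lt_iff_lt.1 ?_, hm, ?_⟩
  · simp only [hb.total]
    have h2 : ((m : ℝ) + 2) ≤ M := by exact_mod_cast hm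
    nlinarith
  -- A postponement by a full period would add at least `2 * lam` to the partial sum while the
  -- cursor stays in row `m`; this would force `b (σ n) > lam`.
  · refine lt_of_le_of_ne hs.lt_perm fun h1 => ?_
    have h2 := hs.perm_sum_gt h
    have h3 := hb.period_le (σ n)
    rw [h1] at hp
    rw [Finset.sum_range_succ] at h2
    linarith

theorem Ready.exists_step (hb : PeriodicWeights M N K lam b)
    (hα : ∀ j : Fin N, α j ^ 2 = b j) {m : Fin M} {n : Fin N} (hs : s.Ready K lam b α σ m n) :
    ∃ (t : STState M N) (τ : Equiv.Perm (Fin N)), s.step = some t ∧ s.col < t.col ∧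
      t.Filled lam (fun i => ∑ j ∈ Finset.range i, b j) α τ ∧
      ((∃ m n, t.Ready K lam b α τ m n) ∨ (t.row = M ∧ t.col = N)) := by
  have hl := hb.lam_pos
  have hp := hs.partial_sum
  have hpos := hs.eig_pos
  have hle := hs.eig_le
  have hn : s.nrm n ^ 2 = b (σ n) := by rw [hs.nrm_eq]; exact hα _
  have hbl := hb.lt_lam (σ n)
  have hbp := hb.pos (σ n)
  rcases le_or_gt (b (σ n)) (s.eig m) with h | h
  -- A postponed norm stays too large for the row, so a norm that fits is in its original place.
  · have hσ : σ n = n := hs.postponed.resolve_right fun h' => h'.1.not_ge h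
    rw [hσ] at h hp hn hbl hbp
    have hF : (s.singleton m n).Filled lam (fun i => ∑ j ∈ Finset.range i, b j) α σ := by
      refine hs.toFilled.singleton hs.row_eq hs.col_eq ?_ ?_ <;> simp only [hσ] <;> linarith
    refine ⟨_, σ, step_eq_singleton hs.row_eq hs.col_eq (hn.trans_le h), Nat.lt_succ_self _, hF,
      hF.ready_or_done hb ?_ ?_ ?_ ?_⟩
    · intro j hj
      refine hs.perm_eq j ?_
      simp only [STState.singleton] at hj
      have := hs.col_eq
      exact Fin.lt_def.2 (by omega)
    · have := m.2
      have := hs.row_eq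
      simp only [STState.singleton]
      split_ifs <;> omega
    · intro r hr
      simp only [STState.singleton, hn, ← hs.col_eq] at hr ⊢
      split_ifs at hr with h0
      · have hrm : (r : ℕ) = m + 1 := by rw [hr, hs.row_eq]
        have hrm' : (r : ℝ) = m + 1 := by exact_mod_cast hrm
        rw [Function.update_of_ne (by rintro rfl; omega),
          hs.eig_above r (by have := hs.row_eq; omega), hrm']
        exact ⟨hl, le_rfl, by linarith⟩
      · obtain rfl : r = m := Fin.ext (hr.trans hs.row_eq.symm)
        rw [Function.update_self]
        exact ⟨lt_of_le_of_ne (by linarith) (Ne.symm h0), by linarith, by linarith⟩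
    · intro hr
      have hm := hs.row_eq
      have := m.2
      simp only [STState.singleton, hn, ← hs.col_eq] at hr ⊢
      split_ifs at hr with h0
      · have hM : ((s.row + 1 : ℕ) : ℝ) = M := congrArg _ hr
        rw [← hM, ← hm]
        push_cast
        linarith
      · omega
  · obtain ⟨hnN, hmM, hnK⟩ := hs.exists_next hb h
    have hgt := hs.perm_sum_gt h
    set n' : Fin N := ⟨n + 1, hnN⟩ with hn'
    have hcn' : (n' : ℕ) = s.col + 1 := by rw [← hs.col_eq]
    have hσ' : σ n' = n' := hs.perm_eq n' (Fin.lt_def.2 (Nat.lt_succ_self _))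
    have hnrm' : s.nrm n' ^ 2 = b (n + 1) := by
      rw [hs.nrm_eq]; simp only [Function.comp, hσ']; exact hα _
    have hb' := hb.pos (n + 1)
    rw [← hn] at h
    rcases lt_or_ge (b (n + 1)) (s.eig m) with h' | h'
    · rw [← hnrm'] at h'
      have hsw1 : (σ * Equiv.swap n n') n = n' := by simp [hσ']
      have hsw2 : (σ * Equiv.swap n n') n' = σ n := by simp
      -- The sum counts the postponed `b (σ n)` too and so exceeds `(m + 1) * lam`, although the
      -- singleton goes in row `m`. This is why the window has width `2 * lam`.
      have hS : (∑ j ∈ Finset.range (n' + 1), b j)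
          = (m + 1) * lam - (s.eig m - b (n + 1)) + b (σ n) := by
        simp only [hn', Finset.sum_range_succ _ ((n : ℕ) + 1)]
        linarith
      have hF : ((s.swapNorms n n').singleton m n).Filled lam
          (fun i => ∑ j ∈ Finset.range i, b j) α (σ * Equiv.swap n n') := by
        refine (hs.toFilled.swapNorms hs.col_eq.ge (by omega)).singleton hs.row_eq hs.col_eq ?_ ?_
          <;> simp only [hsw1, hS] <;> linarith
      have hne : s.eig m - b (n + 1) ≠ 0 := by linarith
      have hnrm : (s.swapNorms n n').nrm n ^ 2 = b (n + 1) := by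
        simpa [STState.swapNorms] using hnrm'
      have heig : ((s.swapNorms n n').singleton m n).eig m = s.eig m - b (n + 1) := by
        simp only [STState.singleton, Function.update_self, hnrm]
        rfl
      refine ⟨_, _, step_eq_swap hs.row_eq hs.col_eq hcn' h h', Nat.lt_succ_self _, hF,
        Or.inl ⟨m, n', { hF with
          row_eq := ?_
          col_eq := hcn'
          perm_eq := ?_
          eig_pos := by rw [heig]; linarith
          eig_le := by rw [heig]; linarith
          perm_le := by rw [hsw2]; exact hs.perm_le.trans (Nat.le_succ _)
          lt_perm := by rw [hsw2]; exact hnK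
          partial_sum := by rw [hsw2, heig, hS]; ring
          postponed := Or.inr ?_ }⟩⟩
      · have : (s.swapNorms n n').eig m - b (n + 1) ≠ 0 := hne
        simp only [STState.singleton, hnrm, if_neg this]
        exact hs.row_eq
      · intro j hj
        have h1 : n < n' := Fin.lt_def.2 (Nat.lt_succ_self _)
        rw [Equiv.Perm.mul_apply, Equiv.swap_apply_of_ne_of_ne (h1.trans hj).ne' hj.ne']
        exact hs.perm_eq j (h1.trans hj)
      · rw [hsw2, heig]
        exact ⟨by linarith, hgt⟩
    · rw [← hnrm'] at h'
      set m' : Fin M := ⟨m + 1, hmM⟩ with hm'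
      have hrm' : (m' : ℕ) = s.row + 1 := by rw [← hs.row_eq]
      obtain ⟨c₁, c₂, c₃, c₄, hstep, e1, e2, e3, e4⟩ :=
        exists_step_eq_block hs.row_eq hrm' hs.col_eq hcn' hpos h h'
      -- This bound keeps the remainder of row `m + 1` positive and the partial sum after the block
      -- below `(m + 2) * lam`.
      have hpair := hb.pair_le (σ n) (n + 1) (by have := hs.perm_le; omega) hnK
      have hmono : ∑ j ∈ Finset.range (σ n + 1), b j ≤ ∑ j ∈ Finset.range (n + 1), b j :=
        hb.strictMono.monotone (Nat.succ_le_succ hs.perm_le)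
      have hS : (∑ j ∈ Finset.range (n + 1 + 1), b j)
          = (m + 1) * lam - s.eig m + b (n + 1) + b (σ n) := by
        rw [Finset.sum_range_succ _ ((n : ℕ) + 1)]
        linarith
      have hF := hs.toFilled.block hs.row_eq hrm' hs.col_eq hcn' e1 e2 e3 e4
        hgt.le (by linarith) (by rw [hσ', hS]; linarith) (by rw [hσ', hS]; linarith) hl
      refine ⟨_, σ, hstep, by simp [STState.block], hF, hF.ready_or_done hb ?_ ?_ ?_ ?_⟩
      · intro j hj
        simp only [STState.block] at hj
        have := hs.col_eq
        exact hs.perm_eq j (Fin.lt_def.2 (by omega))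
      · simp only [STState.block]
        have := hs.row_eq
        omega
      · intro r hr
        simp only [STState.block] at hr
        obtain rfl : r = m' := Fin.ext (by rw [hr, hrm'])
        have hne : m' ≠ m := by
          intro h0
          have := congrArg Fin.val h0
          simp [hm'] at this
        simp only [STState.block, ← hs.col_eq, hn, hnrm']
        rw [Function.update_of_ne hne, Function.update_self,
          hs.eig_above m' (by rw [hrm']; exact Nat.lt_succ_self _), hS]
        simp only [hm', Nat.cast_add, Nat.cast_one]
        exact ⟨by linarith, by linarith, by ring⟩
      · intro hr
        simp only [STState.block] at hr
        have := hs.row_eq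
        omega

/-- The construction runs to the end from every ready state. -/
theorem Ready.exists_run (hb : PeriodicWeights M N K lam b) (hα : ∀ j : Fin N, α j ^ 2 = b j)
    (k : ℕ) : ∀ (s : STState M N) (σ : Equiv.Perm (Fin N)) (m : Fin M) (n : Fin N),
      N - s.col ≤ k → s.Ready K lam b α σ m n →
      ∃ (t : STState M N) (τ : Equiv.Perm (Fin N)),
        Relation.ReflTransGen (fun s t : STState M N => s.step = some t) s t ∧
        t.Filled lam (fun i => ∑ j ∈ Finset.range i, b j) α τ ∧ t.row = M ∧ t.col = N := by
  induction k with
  | zero =>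
    intro s σ m n hk hs
    have := n.2
    have := hs.col_eq
    omega
  | succ k ih =>
    intro s σ m n hk hs
    obtain ⟨t, τ, hst, hcol, hF, h | h⟩ := hs.exists_step hb hα
    · obtain ⟨m', n', ht⟩ := h
      obtain ⟨u, υ, h1, h2⟩ := ih t τ m' n' (by have := n.2; have := hs.col_eq; omega) ht
      exact ⟨u, υ, h1.head hst, h2⟩
    · exact ⟨t, τ, .single hst, hF, h⟩

theorem exists_run_init (hb : PeriodicWeights M N K lam b) (hα : ∀ j : Fin N, α j ^ 2 = b j) :
    ∃ (t : STState M N) (τ : Equiv.Perm (Fin N)),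
      Relation.ReflTransGen (fun s t : STState M N => s.step = some t)
        (STState.init (fun _ => lam) α) t ∧
      t.Filled lam (fun i => ∑ j ∈ Finset.range i, b j) α τ ∧ t.row = M ∧ t.col = N := by
  have hF : (STState.init (M := M) (fun _ => lam) α).Filled lam
      (fun i => ∑ j ∈ Finset.range i, b j) α 1 := Filled.init
  have h := hF.ready_or_done hb (fun _ _ => rfl) (Nat.zero_le _) ?_ ?_
  · rcases h with ⟨m, n, h⟩ | h
    · exact h.exists_run hb hα _ _ _ _ _ le_rfl
    · exact ⟨_, 1, .refl, hF, h⟩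
  · intro m hm
    have : (m : ℝ) = 0 := by exact_mod_cast hm
    simp [STState.init, this, hb.lam_pos]
  · intro hM
    have : (M : ℝ) = 0 := by exact_mod_cast hM.symm
    simp [STState.init, this]

end STState

/-! ### Frame identities from orthogonality, and the size of a weight class -/

theorem Orthonormal.sum_inner_sq_eq_norm_starProjection_sq {E ι : Type*} [NormedAddCommGroup E]
    [InnerProductSpace ℝ E] [FiniteDimensional ℝ E] [Fintype ι] {v : ι → E}
    (hv : Orthonormal ℝ v) (x : E) :
    ∑ i, inner ℝ x (v i) ^ 2 = ‖(Submodule.span ℝ (Set.range v)).starProjection x‖ ^ 2 := by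
  have hz : (Submodule.span ℝ (Set.range v)).starProjection x = ∑ i, inner ℝ x (v i) • v i := by
    refine Submodule.eq_starProjection_of_mem_orthogonal ?_ ?_
    · exact Submodule.sum_mem _ fun i _ =>
        Submodule.smul_mem _ _ (Submodule.subset_span (Set.mem_range_self i))
    · rw [Submodule.mem_orthogonal]
      intro u hu
      induction hu using Submodule.span_induction with
      | mem u hu =>
        obtain ⟨i, rfl⟩ := hu
        rw [inner_sub_right, hv.inner_right_fintype, real_inner_comm, sub_self]
      | zero => exact inner_zero_left _
      | add u w _ _ hu hw => rw [inner_add_left, hu, hw, add_zero]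
      | smul c u _ hu => rw [real_inner_smul_left, hu, mul_zero]
  rw [hz, ← real_inner_self_eq_norm_sq, hv.inner_sum]
  simp [sq]

open scoped Pointwise in
theorem sum_inner_sq_eq_norm_starProjection_sq {E ι : Type*} [NormedAddCommGroup E]
    [InnerProductSpace ℝ E] [FiniteDimensional ℝ E] [Fintype ι] {v : ι → E} {c : ℝ} (hc : 0 < c)
    (hnorm : ∀ i, ‖v i‖ = c) (horth : ∀ i j, i ≠ j → inner ℝ (v i) (v j) = 0) (x : E) :
    ∑ i, inner ℝ x (v i) ^ 2
      = c ^ 2 * ‖(Submodule.span ℝ (Set.range v)).starProjection x‖ ^ 2 := by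
  have hv : Orthonormal ℝ fun i => c⁻¹ • v i := by
    refine ⟨fun i => ?_, fun i j hij => ?_⟩
    · rw [norm_smul, hnorm, norm_inv, Real.norm_of_nonneg hc.le, inv_mul_cancel₀ hc.ne']
    · simp only [real_inner_smul_left, real_inner_smul_right, horth i j hij, mul_zero]
  have hspan : Submodule.span ℝ (Set.range fun i => c⁻¹ • v i)
      = Submodule.span ℝ (Set.range v) := by
    have : (Set.range fun i => c⁻¹ • v i) = c⁻¹ • Set.range v := by
      rw [← Set.image_smul, ← Set.range_comp]; rfl
    rw [this, Submodule.span_smul_eq_of_isUnit _ _ (inv_ne_zero hc.ne').isUnit]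
  rw [← hspan, ← hv.sum_inner_sq_eq_norm_starProjection_sq, Finset.mul_sum]
  refine Finset.sum_congr rfl fun i _ => ?_
  rw [real_inner_smul_right]
  field_simp

theorem finrank_span_range_of_orthogonal {E ι : Type*} [NormedAddCommGroup E]
    [InnerProductSpace ℝ E] [Fintype ι] {v : ι → E} (hne : ∀ i, v i ≠ 0)
    (horth : ∀ i j, i ≠ j → inner ℝ (v i) (v j) = 0) :
    Module.finrank ℝ (Submodule.span ℝ (Set.range v)) = Fintype.card ι :=
  finrank_span_eq_card (linearIndependent_of_ne_zero_of_inner_eq_zero hne fun i j h => horth i j h)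

/-- Orthogonal rows of equal norm make the columns a tight frame: expand the square and sum over the
columns first. -/
theorem EuclideanSpace.sum_inner_sq_of_gram {M N : ℕ} {f : Fin N → EuclideanSpace ℝ (Fin M)}
    {c : ℝ} (hf : ∀ r t, ∑ j, f j r * f j t = if r = t then c else 0)
    (x : EuclideanSpace ℝ (Fin M)) : ∑ j, inner ℝ x (f j) ^ 2 = c * ‖x‖ ^ 2 := by
  have h1 : ∀ j, inner ℝ x (f j) ^ 2 = ∑ r, ∑ t, x r * x t * (f j r * f j t) := by
    intro j
    simp only [PiLp.inner_apply, RCLike.inner_apply, conj_trivial, sq, Finset.sum_mul_sum]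
    exact Finset.sum_congr rfl fun r _ => Finset.sum_congr rfl fun t _ => by ring
  calc ∑ j, inner ℝ x (f j) ^ 2 = ∑ r, ∑ t, ∑ j, x r * x t * (f j r * f j t) := by
        rw [Finset.sum_congr rfl fun j _ => h1 j, Finset.sum_comm]
        exact Finset.sum_congr rfl fun r _ => Finset.sum_comm
    _ = c * ‖x‖ ^ 2 := by
        simp only [← Finset.mul_sum, hf, mul_ite, mul_zero, Finset.sum_ite_eq, Finset.mem_univ,
          if_true]
        rw [EuclideanSpace.real_norm_sq_eq, Finset.mul_sum]
        exact Finset.sum_congr rfl fun r _ => by ring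

theorem Fin.card_modNat_eq (d K : ℕ) (σ : Equiv.Perm (Fin (d * K))) (k : Fin K) :
    Fintype.card {n : Fin (d * K) // (σ n).modNat = k} = d := by
  have e : {n : Fin (d * K) // (σ n).modNat = k} ≃ Fin d :=
    ((σ.trans finProdFinEquiv.symm).subtypeEquiv (q := fun p => p.2 = k) fun _ => Iff.rfl).trans
      { toFun := fun p => p.1.1
        invFun := fun i => ⟨(i, k), rfl⟩
        left_inv := by rintro ⟨⟨i, l⟩, rfl⟩; rfl
        right_inv := fun _ => rfl }
  rw [Fintype.card_congr e, Fintype.card_fin]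

/-! ### Periodic sums and the hypotheses on the weights -/

section Periodic

variable {K : ℕ} {b : ℕ → ℝ}

theorem sum_range_add_period (hb : ∀ i, b (i + K) = b i) (n : ℕ) :
    ∑ j ∈ Finset.range (n + K), b j
      = ∑ j ∈ Finset.range n, b j + ∑ j ∈ Finset.range K, b j := by
  induction n with
  | zero => simp
  | succ n ih =>
    rw [Nat.add_right_comm, Finset.sum_range_succ, ih, Finset.sum_range_succ, hb]
    ring

theorem sum_range_mul_period (hb : ∀ i, b (i + K) = b i) (d : ℕ) :
    ∑ j ∈ Finset.range (d * K), b j = d * ∑ j ∈ Finset.range K, b j := by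
  induction d with
  | zero => simp
  | succ d ih =>
    rw [Nat.succ_mul, sum_range_add_period hb, ih]
    push_cast
    ring

end Periodic

theorem PeriodicWeights.of_pair_le {M K d : ℕ} (hM : 0 < M) (hK : 2 ≤ K) {a : Fin K → ℝ}
    (ha_pos : ∀ k, 0 < a k) {lam : ℝ} (hlam : lam = (d : ℝ) * (∑ k, a k ^ 2) / (M : ℝ))
    (hpair : ∀ p q : Fin K, p < q → a p ^ 2 + a q ^ 2 ≤ lam)
    (hd : (d : ℝ) / (M : ℝ) ≤ 1 / 2) :
    PeriodicWeights M (d * K) K lam fun i => a ⟨i % K, Nat.mod_lt _ (by omega)⟩ ^ 2 := by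
  have hper : ∀ i, a ⟨(i + K) % K, Nat.mod_lt _ (by omega)⟩ ^ 2
      = a ⟨i % K, Nat.mod_lt _ (by omega)⟩ ^ 2 := by
    intro i
    simp only [Nat.add_mod_right]
  have hS : ∑ j ∈ Finset.range K, a ⟨j % K, Nat.mod_lt _ (by omega)⟩ ^ 2 = ∑ k, a k ^ 2 := by
    rw [Finset.sum_range]
    exact Finset.sum_congr rfl fun k _ => by simp only [Nat.mod_eq_of_lt k.2]
  have hM' : (0 : ℝ) < M := by exact_mod_cast hM
  refine ⟨hK, fun i => pow_pos (ha_pos _) 2, fun i j hij hji => ?_, fun i => ?_, ?_⟩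
  · have hne : i % K ≠ j % K := by
      intro h
      have h1 : K ∣ j - i := (Nat.modEq_iff_dvd' hij.le).1 h
      have := Nat.le_of_dvd (by omega) h1
      omega
    rcases lt_or_gt_of_ne hne with h | h
    · exact hpair _ _ (Fin.lt_def.2 h)
    · rw [add_comm]
      exact hpair _ _ (Fin.lt_def.2 h)
  -- One period sums to `∑ k, a k ^ 2`, and `lam` is `d / M ≤ 1 / 2` times that.
  · rw [sum_range_add_period hper, hS, hlam, mul_div_right_comm]
    have : 0 ≤ ∑ k, a k ^ 2 := Finset.sum_nonneg fun k _ => sq_nonneg _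
    nlinarith
  · rw [sum_range_mul_period hper, hS, hlam]
    field_simp

/-! ### Orthogonality within a weight class and the conclusion -/

/-- Vectors of a completed run whose original positions agree modulo the period are orthogonal. -/
theorem STState.Filled.inner_eq_zero {M N K : ℕ} {lam : ℝ} {b : ℕ → ℝ} {α : Fin N → ℝ}
    {σ : Equiv.Perm (Fin N)} {s : STState M N} (hb : PeriodicWeights M N K lam b)
    (hs : s.Filled lam (fun i => ∑ j ∈ Finset.range i, b j) α σ) (hcol : s.col = N)
    {i j : Fin N} (hij : i ≠ j) (hmod : (σ i : ℕ) % K = σ j % K) :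
    inner ℝ (s.vec i) (s.vec j) = 0 := by
  wlog hlt : (σ i : ℕ) < σ j generalizing i j
  · rw [real_inner_comm]
    refine this hij.symm hmod.symm (lt_of_le_of_ne (not_lt.1 hlt) fun h => hij ?_)
    exact (σ.injective (Fin.ext h)).symm
  rw [PiLp.inner_apply]
  refine Finset.sum_eq_zero fun r _ => ?_
  by_contra h
  simp only [RCLike.inner_apply, conj_trivial] at h
  have hi := hs.supp i (i.2.trans_eq hcol.symm) r (right_ne_zero_of_mul h)
  have hj := hs.supp j (j.2.trans_eq hcol.symm) r (left_ne_zero_of_mul h)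
  have hle : (σ i : ℕ) + K ≤ σ j := by
    have := Nat.le_of_dvd (by omega) ((Nat.modEq_iff_dvd' hlt.le).1 hmod)
    omega
  have h1 : ∑ l ∈ Finset.range (σ i + 1 + K), b l ≤ ∑ l ∈ Finset.range (σ j + 1), b l :=
    hb.strictMono.monotone (by omega)
  have h2 := hb.period_le (σ i + 1)
  linarith [hi.1, hj.2]

theorem mainTheorem6 (M K d : ℕ) (hM : 0 < M) (hK : 2 ≤ K)
    (a : Fin K → ℝ) (ha_pos : ∀ k, 0 < a k) (ha_mono : Monotone a)
    (lam : ℝ) (hlam : lam = (d : ℝ) * (∑ k, a k ^ 2) / (M : ℝ))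
    (htop : a ⟨K - 2, by omega⟩ ^ 2 + a ⟨K - 1, by omega⟩ ^ 2 ≤ lam)
    (hd : (d : ℝ) / (M : ℝ) ≤ 1 / 2) :
    ∃ f : Fin (d * K) → EuclideanSpace ℝ (Fin M),
      STOutputs (fun _ : Fin M => lam) (periodicList d a) f ∧
      ∃ (J : Fin (d * K) → Fin K) (W : Fin K → Submodule ℝ (EuclideanSpace ℝ (Fin M))),
        Generates f J W a ∧
        (∀ k, Module.finrank ℝ (W k) = d) ∧
        IsTightFusionFrame W a lam := by
  have hpair : ∀ p q : Fin K, p < q → a p ^ 2 + a q ^ 2 ≤ lam := by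
    intro p q hpq
    have h1 : a p ≤ a ⟨K - 2, by omega⟩ :=
      ha_mono (Fin.le_def.2 (by have := q.2; have := Fin.lt_def.1 hpq; simp only; omega))
    have h2 : a q ≤ a ⟨K - 1, by omega⟩ :=
      ha_mono (Fin.le_def.2 (by have := q.2; simp only; omega))
    exact (add_le_add (pow_le_pow_left₀ (ha_pos p).le h1 2)
      (pow_le_pow_left₀ (ha_pos q).le h2 2)).trans htop
  have hb := PeriodicWeights.of_pair_le hM hK ha_pos hlam hpair hd
  obtain ⟨t, σ, hrun, hF, hrow, hcol⟩ :=
    STState.exists_run_init hb (α := periodicList d a) fun _ => rfl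
  have hnorm : ∀ n, ‖t.vec n‖ = a (σ n).modNat := by
    intro n
    refine (pow_left_inj₀ (norm_nonneg _) (ha_pos _).le two_ne_zero).1 ?_
    rw [EuclideanSpace.real_norm_sq_eq, hF.norm n (n.2.trans_eq hcol.symm), hF.nrm_eq]
    rfl
  -- Classes are formed by original position `σ n`, not by column, because re-ordering moves the
  -- norms.
  set W : Fin K → Submodule ℝ (EuclideanSpace ℝ (Fin M)) := fun k =>
    Submodule.span ℝ (Set.range fun n : {n // (σ n).modNat = k} => t.vec n) with hW
  have hnorm' : ∀ k, ∀ n : {n // (σ n).modNat = k}, ‖t.vec n‖ = a k := by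
    rintro k ⟨n, rfl⟩
    exact hnorm n
  have horth : ∀ k, ∀ n n' : {n // (σ n).modNat = k}, n ≠ n' →
      inner ℝ (t.vec n) (t.vec n') = 0 := fun k n n' h =>
    hF.inner_eq_zero hb hcol (fun h' => h (Subtype.ext h'))
      (congrArg Fin.val (n.2.trans n'.2.symm))
  have hpart : ∀ k x, ∑ n with (σ n).modNat = k, inner ℝ x (t.vec n) ^ 2
      = a k ^ 2 * ‖(W k).starProjection x‖ ^ 2 := by
    intro k x
    rw [← sum_inner_sq_eq_norm_starProjection_sq (ha_pos k) (hnorm' k) (horth k) x]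
    exact Finset.sum_subtype _ (by simp) _
  refine ⟨t.vec, ⟨t, hrun, hrow, hcol, rfl⟩, fun n => (σ n).modNat, W, fun k =>
    ⟨pow_pos (ha_pos k) 2, fun n hn => ?_, fun x hx => ?_⟩, fun k => ?_, ha_pos, hb.lam_pos,
    fun x => ?_⟩
  · exact Submodule.subset_span ⟨⟨n, (Finset.mem_filter.1 hn).2⟩, rfl⟩
  · rw [hpart, Submodule.starProjection_eq_self_iff.2 hx]
  · rw [hW, finrank_span_range_of_orthogonal (fun n => ?_) (horth k), Fin.card_modNat_eq]
    rw [← norm_ne_zero_iff, hnorm' k n]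
    exact (ha_pos k).ne'
  · simp only [← hpart]
    -- The classes partition all columns, so only the tightness of the whole family remains.
    rw [Finset.sum_fiberwise]
    refine EuclideanSpace.sum_inner_sq_of_gram (fun r r' => ?_) x
    rw [hF.gram, hF.eig_below r (r.2.trans_eq hrow.symm), sub_zero]
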